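/- Let $C$ be a finite set of Hermitian complex $n\times n$ matrices, let $1\le m\le |C|$, and let $c,\sigma_0\in\mathbb{R}$. Let $\|\cdot\|$ denote the operator norm, and let $\mathbb{E}[f(X)]=\frac1{|C|}\sum_{A\in C}f(A)$ be the expectation for $X$ uniformly distributed on $C$. Assume that $C$ is centered, $\mathbb{E}[X]=0$, that $\|A\|\le c$ for every $A\in C$, and that $\|\mathbb{E}[X^2]\|\le\sigma_0^2$. Let $X_1,\dots,X_m$ be independent random variables, each uniformly distributed on $C$ (sampling with replacement), and let $(Y_1,\dots,Y_m)$ be uniformly distributed on the set of $m$-tuples of pairwise distinct elements of $C$ (sampling without replacement). Put $S_{\mathbf X}=\sum_{i=1}^m X_i$, $S_{\mathbf Y}=\sum_{i=1}^m Y_i$ and $V=m\sigma_0^2$. Then for both $S=S_{\mathbf X}$ and $S=S_{\mathbf Y}$ and every real $t\ge 0$: $$\Pr\big[\|S\|>t\big]\le 2n\exp\left(-\frac{t^2}{4V}\right)\quad\text{if } t\le \frac{2V}{c},$$ $$\Pr\big[\|S\|>t\big]\le 2n\exp\left(-\frac{t}{2c}\right)\quad\text{if } t>\frac{2V}{c}.$$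 (If $c=0$ or $V=0$, then all elements of $C$ are zero; a quotient with denominator $0$ is then read as $0$.) -/

import Mathlib

open MeasureTheory ProbabilityTheory
-- `‖A‖` on matrices is the operator norm induced by the Euclidean norm.
open scoped Matrix.Norms.L2Operator

/-- The entrywise (product, equivalently Borel) `σ`-algebra on complex `n × n` matrices. -/
noncomputable instance Matrix.complexSquareMeasurableSpace (n : ℕ) :
    MeasurableSpace (Matrix (Fin n) (Fin n) ℂ) :=
  (MeasurableSpace.pi : MeasurableSpace (Fin n → Fin n → ℂ))

instance Matrix.complexSquareMeasurableSingletonClass (n : ℕ) :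
    MeasurableSingletonClass (Matrix (Fin n) (Fin n) ℂ) :=
  inferInstanceAs (MeasurableSingletonClass (Fin n → Fin n → ℂ))

/-- The expectation `E[f(X)]` for `X` uniformly distributed on the finite set `C`. -/
noncomputable def uniformMean {n : ℕ} (C : Finset (Matrix (Fin n) (Fin n) ℂ))
    (f : Matrix (Fin n) (Fin n) ℂ → Matrix (Fin n) (Fin n) ℂ) : Matrix (Fin n) (Fin n) ℂ :=
  (C.card : ℂ)⁻¹ • ∑ A ∈ C, f A

/-- `X 0, …, X (m - 1)` are independent random variables, each uniform on `C`. -/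
structure IsSampleWithReplacement {Ω : Type*} [MeasurableSpace Ω] (P : Measure Ω) {n m : ℕ}
    (C : Finset (Matrix (Fin n) (Fin n) ℂ)) (X : Fin m → Ω → Matrix (Fin n) (Fin n) ℂ) :
    Prop where
  uniform : ∀ i, HasLaw (X i) (uniformOn (C : Set (Matrix (Fin n) (Fin n) ℂ))) P
  indep : iIndepFun X P

/-- The random vector `(Y 0, …, Y (m - 1))` is uniform on the `m`-tuples of pairwise distinct
elements of `C`. -/
def IsSampleWithoutReplacement {Ω : Type*} [MeasurableSpace Ω] (P : Measure Ω) {n m : ℕ}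
    (C : Finset (Matrix (Fin n) (Fin n) ℂ)) (Y : Fin m → Ω → Matrix (Fin n) (Fin n) ℂ) : Prop :=
  HasLaw (fun ω i => Y i ω)
    (uniformOn {y : Fin m → Matrix (Fin n) (Fin n) ℂ | (∀ i, y i ∈ C) ∧ Function.Injective y}) P

/-! The proof is the matrix Laplace transform method. If `‖S‖ > t`, then `S` or `-S` has an
eigenvalue above `t`, so Markov's inequality bounds the tail by `e^(-rt) E[tr e^(rS) + tr e^(-rS)]`
for `r ≥ 0`. With replacement, Golden–Thompson splits off one sample at a time. When `rc ≤ 1`, the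
bound `e^(rX) ≤ 1 + rX + r²X²` and centering make each sample cost a factor at most `1 + r²σ₀² ≤
e^(r²σ₀²)`, whence `E tr e^(±rS) ≤ n e^(r²V)` (`sum_re_trace_exp_smul_sum_le`). Without replacement,
`tr exp` is convex on Hermitian matrices (`convexOn_re_trace_exp`), so Hoeffding's comparison shows
that the same bound holds. Choosing `r` to make `r²V - rt` small gives the two regimes.
Golden–Thompson follows from `|tr (PQ)^N| ≤ |tr P^N Q^N|` for `N = 2^k` and the Lie–Trotter formula.
-/

namespace Matrix

/-! ### Trace inequalities for powers of two. -/

variable {ι : Type*} [Fintype ι]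

theorem trace_mul_conjTranspose_self_eq_sum (X : Matrix ι ι ℂ) :
    (X * Xᴴ).trace = ((∑ i, ∑ j, ‖X i j‖ ^ 2 : ℝ) : ℂ) := by
  simp only [trace, diag_apply, mul_apply, conjTranspose_apply]
  push_cast
  refine Finset.sum_congr rfl fun i _ => Finset.sum_congr rfl fun j _ => ?_
  exact RCLike.mul_conj (X i j)

/-- The Hilbert–Schmidt Cauchy–Schwarz inequality, in arithmetic-mean form. -/
theorem norm_trace_mul_le (X Y : Matrix ι ι ℂ) :
    ‖(X * Y).trace‖ ≤ (‖(X * Xᴴ).trace‖ + ‖(Y * Yᴴ).trace‖) / 2 := by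
  have hn : ∀ Z : Matrix ι ι ℂ, ‖(Z * Zᴴ).trace‖ = ∑ i, ∑ j, ‖Z i j‖ ^ 2 := fun Z => by
    rw [trace_mul_conjTranspose_self_eq_sum, Complex.norm_real, Real.norm_of_nonneg (by positivity)]
  rw [hn, hn, Finset.sum_comm (f := fun i j => ‖Y i j‖ ^ 2), ← Finset.sum_add_distrib,
    Finset.sum_div]
  simp only [trace, diag_apply, mul_apply]
  refine (norm_sum_le _ _).trans (Finset.sum_le_sum fun i _ => ?_)
  rw [← Finset.sum_add_distrib, Finset.sum_div]
  refine (norm_sum_le _ _).trans (Finset.sum_le_sum fun j _ => ?_)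
  rw [norm_mul]
  nlinarith [sq_nonneg (‖X i j‖ - ‖Y j i‖)]

variable [DecidableEq ι]

theorem trace_mul_pow_comm (A B : Matrix ι ι ℂ) (N : ℕ) :
    ((A * B) ^ N).trace = ((B * A) ^ N).trace := by
  cases N with
  | zero => simp
  | succ N =>
    have h : (A * B) ^ (N + 1) = A * ((B * A) ^ N * B) := by
      induction N with
      | zero => simp
      | succ N ih => rw [pow_succ, ih, pow_succ (B * A) N]; simp only [mul_assoc]
    rw [h, trace_mul_comm, pow_succ]
    simp only [mul_assoc]

/-- For `X = PQ`, `X Xᴴ = P Q² P`, which is cyclically `P² Q²`. The bound on `X` is a hypothesis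
because `norm_trace_pow_le` uses this lemma in its own induction. -/
theorem norm_trace_mul_pow_le_sq_of {k : ℕ}
    (hk : ∀ X : Matrix ι ι ℂ, ‖(X ^ 2 ^ (k + 1)).trace‖ ≤ ‖((X * Xᴴ) ^ 2 ^ k).trace‖)
    {P Q : Matrix ι ι ℂ} (hP : P.IsHermitian) (hQ : Q.IsHermitian) :
    ‖((P * Q) ^ 2 ^ (k + 1)).trace‖ ≤ ‖((P ^ 2 * Q ^ 2) ^ 2 ^ k).trace‖ := by
  refine (hk (P * Q)).trans_eq ?_
  rw [conjTranspose_mul, hP.eq, hQ.eq, ← mul_assoc, trace_mul_pow_comm, sq, sq]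
  simp only [mul_assoc]

/-- Each doubling step squares `P` and `Q` and halves the exponent. Only levels `j < k` enter, so a
strong induction can call it. -/
theorem norm_trace_mul_pow_le_of {k : ℕ}
    (hk : ∀ j < k, ∀ X : Matrix ι ι ℂ, ‖(X ^ 2 ^ (j + 1)).trace‖ ≤ ‖((X * Xᴴ) ^ 2 ^ j).trace‖)
    {P Q : Matrix ι ι ℂ} (hP : P.IsHermitian) (hQ : Q.IsHermitian) :
    ‖((P * Q) ^ 2 ^ k).trace‖ ≤ ‖(P ^ 2 ^ k * Q ^ 2 ^ k).trace‖ := by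
  induction k generalizing P Q with
  | zero => simp
  | succ k ih =>
    refine (norm_trace_mul_pow_le_sq_of (hk k k.lt_succ_self) hP hQ).trans ?_
    refine (ih (fun j hj => hk j (hj.trans k.lt_succ_self)) (hP.pow 2) (hQ.pow 2)).trans_eq ?_
    rw [← pow_mul, ← pow_mul, ← pow_succ']

/-- The induction hypothesis for `X²` leads, by cyclicity, to powers of `(Xᴴ X)(X Xᴴ)`. Both factors
are Hermitian, so lower levels separate their powers; Cauchy–Schwarz then leaves two traces that
agree by cyclicity. -/
theorem norm_trace_pow_le (k : ℕ) (X : Matrix ι ι ℂ) :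
    ‖(X ^ 2 ^ (k + 1)).trace‖ ≤ ‖((X * Xᴴ) ^ 2 ^ k).trace‖ := by
  induction k using Nat.strong_induction_on generalizing X with
  | _ k ih =>
  cases k with
  | zero => simpa [sq] using norm_trace_mul_le X X
  | succ k =>
    have hP : (Xᴴ * X).IsHermitian := isHermitian_conjTranspose_mul_self X
    have hQ : (X * Xᴴ).IsHermitian := isHermitian_mul_conjTranspose_self X
    calc ‖(X ^ 2 ^ (k + 1 + 1)).trace‖ = ‖((X ^ 2) ^ 2 ^ (k + 1)).trace‖ := by
          rw [← pow_mul, ← pow_succ']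
      _ ≤ ‖((X ^ 2 * (X ^ 2)ᴴ) ^ 2 ^ k).trace‖ := ih k k.lt_succ_self (X ^ 2)
      _ = ‖((Xᴴ * X * (X * Xᴴ)) ^ 2 ^ k).trace‖ := by
          rw [mul_assoc Xᴴ, trace_mul_pow_comm Xᴴ, conjTranspose_pow, sq, sq]
          simp only [mul_assoc]
      _ ≤ ‖((Xᴴ * X) ^ 2 ^ k * (X * Xᴴ) ^ 2 ^ k).trace‖ :=
          norm_trace_mul_pow_le_of (fun j hj => ih j (hj.trans k.lt_succ_self)) hP hQ
      _ ≤ (‖((Xᴴ * X) ^ 2 ^ (k + 1)).trace‖ + ‖((X * Xᴴ) ^ 2 ^ (k + 1)).trace‖) / 2 := by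
          refine (norm_trace_mul_le _ _).trans_eq ?_
          rw [(hP.pow _).eq, (hQ.pow _).eq, ← sq, ← sq, ← pow_mul, ← pow_mul, ← pow_succ]
      _ = _ := by rw [trace_mul_pow_comm Xᴴ]; ring

/-- For Hermitian matrices, `|tr (P Q) ^ N| ≤ |tr (P ^ N Q ^ N)|` when `N` is a power of two. -/
theorem IsHermitian.norm_trace_mul_pow_le {P Q : Matrix ι ι ℂ} (hP : P.IsHermitian)
    (hQ : Q.IsHermitian) (k : ℕ) :
    ‖((P * Q) ^ 2 ^ k).trace‖ ≤ ‖(P ^ 2 ^ k * Q ^ 2 ^ k).trace‖ :=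
  norm_trace_mul_pow_le_of (fun j _ => norm_trace_pow_le j) hP hQ

end Matrix

/-! ### The Lie–Trotter product formula. -/

section LieTrotter

open Filter Topology NormedSpace

/-- Telescoping gives `N` terms with `N - 1` factors bounded by `M`; `1 ≤ M` allows the exponent
`N`. -/
theorem norm_pow_sub_pow_le_mul {R : Type*} [NormedRing R] [NormOneClass R] {x y : R} {M : ℝ}
    (hM : 1 ≤ M) (hx : ‖x‖ ≤ M) (hy : ‖y‖ ≤ M) (N : ℕ) :
    ‖x ^ N - y ^ N‖ ≤ M ^ N * (N * ‖x - y‖) := by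
  have hM0 : 0 ≤ M := zero_le_one.trans hM
  induction N with
  | zero => simp
  | succ N ih =>
    have hy' : ‖y ^ N‖ ≤ M ^ N := (norm_pow_le y N).trans (pow_le_pow_left₀ (norm_nonneg y) hy N)
    have h : x ^ (N + 1) - y ^ (N + 1) = x * (x ^ N - y ^ N) + (x - y) * y ^ N := by
      rw [pow_succ', pow_succ']; noncomm_ring
    calc ‖x ^ (N + 1) - y ^ (N + 1)‖ ≤ ‖x‖ * ‖x ^ N - y ^ N‖ + ‖x - y‖ * ‖y ^ N‖ := by
          rw [h]
          exact (norm_add_le _ _).trans (add_le_add (norm_mul_le _ _) (norm_mul_le _ _))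
      _ ≤ M * (M ^ N * (N * ‖x - y‖)) + ‖x - y‖ * (M * M ^ N) := by
          gcongr
          exact hy'.trans (le_mul_of_one_le_left (by positivity) hM)
      _ = M ^ (N + 1) * ((N + 1 : ℕ) * ‖x - y‖) := by push_cast; ring

variable {𝔸 : Type*} [NormedRing 𝔸] [NormOneClass 𝔸] [NormedAlgebra ℝ 𝔸]

theorem norm_exp_le_exp_norm (a : 𝔸) : ‖exp a‖ ≤ Real.exp ‖a‖ := by
  rw [exp_eq_tsum ℝ, Real.exp_eq_exp_ℝ, exp_eq_tsum ℝ]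
  refine tsum_of_norm_bounded (NormedSpace.expSeries_summable' (𝕂 := ℝ) ‖a‖).hasSum fun k => ?_
  rw [norm_smul, smul_eq_mul, Real.norm_of_nonneg (by positivity)]
  gcongr
  exact norm_pow_le a k

variable [CompleteSpace 𝔸]

/-- The Lie–Trotter product formula. -/
theorem tendsto_exp_mul_exp_pow (a b : 𝔸) :
    Tendsto (fun N : ℕ => (exp ((N : ℝ)⁻¹ • a) * exp ((N : ℝ)⁻¹ • b)) ^ N) atTop
      (𝓝 (exp (a + b))) := by
  set f : ℝ → 𝔸 := fun t => exp (t • a) * exp (t • b) - exp (t • (a + b)) with hf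
  -- The error `f` of one step vanishes to first order, so `N` such errors of step size `1/N` add up
  -- to `o(1)`.
  have hder : HasDerivAt f 0 0 := by
    have h := ((hasDerivAt_exp_smul_const a (0 : ℝ)).mul (hasDerivAt_exp_smul_const b (0 : ℝ))).sub
      (hasDerivAt_exp_smul_const (a + b) (0 : ℝ))
    exact h.congr_deriv (by simp)
  have hinv : Tendsto (fun N : ℕ => (N : ℝ)⁻¹) atTop (𝓝[≠] 0) :=
    tendsto_nhdsWithin_iff.2 ⟨tendsto_inv_atTop_nhds_zero_nat, by
      filter_upwards [eventually_gt_atTop 0] with N hN using by simp [hN.ne']⟩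
  have hlim : Tendsto (fun N : ℕ => (N : ℝ) * ‖f (N : ℝ)⁻¹‖) atTop (𝓝 0) := by
    have h := (hder.tendsto_slope_zero.comp hinv).norm
    simpa [Function.comp_def, hf, norm_smul] using h
  rw [tendsto_iff_norm_sub_tendsto_zero]
  refine squeeze_zero' (Eventually.of_forall fun _ => norm_nonneg _) ?_
    (by simpa using hlim.const_mul (Real.exp (‖a‖ + ‖b‖)))
  filter_upwards [eventually_gt_atTop 0] with N hN
  have hN' : (N : ℝ) ≠ 0 := by positivity
  have hs : ∀ c : 𝔸, ‖exp ((N : ℝ)⁻¹ • c)‖ ≤ Real.exp ((N : ℝ)⁻¹ * ‖c‖) := fun c => by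
    simpa [norm_smul] using norm_exp_le_exp_norm ((N : ℝ)⁻¹ • c)
  let _ : NormedAlgebra ℚ 𝔸 := NormedAlgebra.restrictScalars ℚ ℝ 𝔸
  have hpow : exp (a + b) = exp ((N : ℝ)⁻¹ • (a + b)) ^ N := by
    rw [← NormedSpace.exp_nsmul, ← Nat.cast_smul_eq_nsmul ℝ, smul_smul, mul_inv_cancel₀ hN', one_smul]
  -- With this `M` in the telescoping bound, `M ^ N` does not depend on `N`.
  have hMN : Real.exp ((N : ℝ)⁻¹ * (‖a‖ + ‖b‖)) ^ N = Real.exp (‖a‖ + ‖b‖) := by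
    rw [← Real.exp_nat_mul, mul_inv_cancel_left₀ hN']
  rw [hpow, ← hMN]
  refine norm_pow_sub_pow_le_mul (Real.one_le_exp (by positivity)) ?_ ?_ N
  · refine (norm_mul_le _ _).trans ?_
    rw [mul_add, Real.exp_add]
    exact mul_le_mul (hs a) (hs b) (norm_nonneg _) (Real.exp_nonneg _)
  · refine (hs _).trans (Real.exp_le_exp.2 ?_)
    gcongr
    exact norm_add_le a b

end LieTrotter

/-! ### The Golden–Thompson inequality. -/

namespace Matrix

open Filter Topology NormedSpace

variable {ι : Type*} [Fintype ι] [DecidableEq ι]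

/-- The **Golden–Thompson inequality**. -/
theorem norm_trace_exp_add_le_of_isHermitian {A B : Matrix ι ι ℂ} (hA : A.IsHermitian)
    (hB : B.IsHermitian) : ‖(exp (A + B)).trace‖ ≤ ‖(exp A * exp B).trace‖ := by
  cases isEmpty_or_nonempty ι
  · simp [trace]
  have hsmul : ∀ {C : Matrix ι ι ℂ} (r : ℝ), C.IsHermitian → (r • C).IsHermitian := fun r hC =>
    hC.smul (IsSelfAdjoint.all r)
  have hpow : ∀ (C : Matrix ι ι ℂ) (k : ℕ), exp (((2 ^ k : ℕ) : ℝ)⁻¹ • C) ^ 2 ^ k = exp C :=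
    fun C k => by
      rw [← Matrix.exp_nsmul, ← Nat.cast_smul_eq_nsmul ℝ, smul_smul,
        mul_inv_cancel₀ (by positivity), one_smul]
  -- Along `N = 2 ^ k` the trace inequality applies, and its right-hand side is the same for all
  -- `k`.
  have hlim := (tendsto_exp_mul_exp_pow A B).comp (tendsto_pow_atTop_atTop_of_one_lt one_lt_two)
  have htr : Continuous fun M : Matrix ι ι ℂ => ‖M.trace‖ :=
    (continuous_id.matrix_trace).norm
  refine le_of_tendsto ((htr.tendsto _).comp hlim) (Eventually.of_forall fun k => ?_)
  have h := ((hsmul (((2 ^ k : ℕ) : ℝ)⁻¹) hA).exp).norm_trace_mul_pow_le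
    ((hsmul (((2 ^ k : ℕ) : ℝ)⁻¹) hB).exp) k
  rwa [hpow, hpow] at h

end Matrix

/-! ### Spectral bounds and convexity of the trace exponential. -/

namespace Matrix

open NormedSpace
open scoped ComplexOrder MatrixOrder

variable {ι : Type*} [Fintype ι] [DecidableEq ι]

theorem exp_unitary_conj (U : unitaryGroup ι ℂ) (A : Matrix ι ι ℂ) :
    exp ((U : Matrix ι ι ℂ) * A * star (U : Matrix ι ι ℂ)) =
      (U : Matrix ι ι ℂ) * exp A * star (U : Matrix ι ι ℂ) :=
  Matrix.exp_units_conj (Unitary.toUnits U) A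

theorem trace_unitary_conj (U : unitaryGroup ι ℂ) (A : Matrix ι ι ℂ) :
    ((U : Matrix ι ι ℂ) * A * star (U : Matrix ι ι ℂ)).trace = A.trace := by
  rw [trace_mul_cycle, Unitary.coe_star_mul_self, one_mul]

theorem exp_diagonal_ofReal (d : ι → ℝ) :
    exp (diagonal fun i => (d i : ℂ)) = diagonal fun i => ((Real.exp (d i) : ℝ) : ℂ) := by
  rw [Matrix.exp_diagonal]
  congr 1
  funext i
  rw [Pi.coe_exp, ← Complex.exp_eq_exp_ℂ, Complex.ofReal_exp]

theorem eq_unitary_conj_diagonal {A : Matrix ι ι ℂ} (hA : A.IsHermitian) :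
    A = (hA.eigenvectorUnitary : Matrix ι ι ℂ) * diagonal (fun i => (hA.eigenvalues i : ℂ)) *
      star (hA.eigenvectorUnitary : Matrix ι ι ℂ) := by
  conv_lhs => rw [hA.spectral_theorem, Unitary.conjStarAlgAut_apply]
  rfl

theorem exp_eq_unitary_conj_diagonal {A : Matrix ι ι ℂ} (hA : A.IsHermitian) (r : ℝ) :
    exp (r • A) = (hA.eigenvectorUnitary : Matrix ι ι ℂ) *
      diagonal (fun i => ((Real.exp (r * hA.eigenvalues i) : ℝ) : ℂ)) *
      star (hA.eigenvectorUnitary : Matrix ι ι ℂ) := by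
  conv_lhs => rw [eq_unitary_conj_diagonal hA]
  rw [← exp_diagonal_ofReal, ← exp_unitary_conj]
  congr 1
  rw [← smul_mul_assoc, ← mul_smul_comm]
  congr 2
  ext i j
  by_cases h : i = j <;> simp [h]

theorem re_trace_exp_smul {A : Matrix ι ι ℂ} (hA : A.IsHermitian) (r : ℝ) :
    (exp (r • A)).trace.re = ∑ i, Real.exp (r * hA.eigenvalues i) := by
  rw [exp_eq_unitary_conj_diagonal hA, trace_unitary_conj, trace_diagonal, ← Complex.ofReal_sum,
    Complex.ofReal_re]

theorem norm_eq_norm_eigenvalues {A : Matrix ι ι ℂ} (hA : A.IsHermitian) :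
    ‖A‖ = ‖hA.eigenvalues‖ := by
  conv_lhs => rw [eq_unitary_conj_diagonal hA]
  rw [← Unitary.coe_star, CStarRing.norm_mul_coe_unitary, CStarRing.norm_coe_unitary_mul,
    l2_opNorm_diagonal]
  simp only [Pi.norm_def, nnnorm, Complex.norm_real]

theorem abs_eigenvalues_le_norm {A : Matrix ι ι ℂ} (hA : A.IsHermitian) (i : ι) :
    |hA.eigenvalues i| ≤ ‖A‖ :=
  (norm_le_pi_norm hA.eigenvalues i).trans_eq (norm_eq_norm_eigenvalues hA).symm

/-- Scalar inequalities between `exp` and a quadratic polynomial on the eigenvalues of a Hermitian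
matrix transfer to the matrix. -/
theorem posSemidef_exp_add_quadratic {A : Matrix ι ι ℂ} (hA : A.IsHermitian) {s α β γ : ℝ}
    (h : ∀ i, 0 ≤ s * Real.exp (hA.eigenvalues i) + α + β * hA.eigenvalues i +
      γ * hA.eigenvalues i ^ 2) :
    (s • exp A + α • 1 + β • A + γ • A ^ 2).PosSemidef := by
  set U := hA.eigenvectorUnitary
  set D : Matrix ι ι ℂ := diagonal fun i => (hA.eigenvalues i : ℂ)
  have hAD : A = (U : Matrix ι ι ℂ) * D * star (U : Matrix ι ι ℂ) := eq_unitary_conj_diagonal hA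
  have hE := exp_eq_unitary_conj_diagonal hA 1
  simp only [one_smul, one_mul] at hE
  set E : Matrix ι ι ℂ := diagonal fun i => ((Real.exp (hA.eigenvalues i) : ℝ) : ℂ)
  have hUU : star (U : Matrix ι ι ℂ) * (U : Matrix ι ι ℂ) = 1 := Unitary.coe_star_mul_self U
  have hUU' : (U : Matrix ι ι ℂ) * star (U : Matrix ι ι ℂ) = 1 := Unitary.coe_mul_star_self U
  have hA2 : A ^ 2 = (U : Matrix ι ι ℂ) * (D * D) * star (U : Matrix ι ι ℂ) := by
    rw [sq]
    nth_rw 1 [hAD]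
    nth_rw 1 [hAD]
    simp only [mul_assoc]
    rw [← mul_assoc (star (U : Matrix ι ι ℂ)), hUU, one_mul]
  have key : s • exp A + α • 1 + β • A + γ • A ^ 2 = (U : Matrix ι ι ℂ) *
      (s • E + α • 1 + β • D + γ • (D * D)) * star (U : Matrix ι ι ℂ) := by
    have hb : β • A = β • ((U : Matrix ι ι ℂ) * D * star (U : Matrix ι ι ℂ)) := by rw [← hAD]
    rw [hE, hA2, hb]
    simp only [mul_add, add_mul, mul_smul_comm, smul_mul_assoc, mul_one, hUU']
    rfl
  rw [key]
  refine PosSemidef.mul_mul_conjTranspose_same ?_ _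
  have hdiag : s • E + α • 1 + β • D + γ • (D * D) = diagonal fun i =>
      ((s * Real.exp (hA.eigenvalues i) + α + β * hA.eigenvalues i +
        γ * hA.eigenvalues i ^ 2 : ℝ) : ℂ) := by
    ext i j
    by_cases hij : i = j <;> simp [E, D, hij, sq]
  rw [hdiag]
  exact PosSemidef.diagonal fun i => by
    simpa only [Pi.zero_apply, Complex.zero_le_real] using h i

theorem posSemidef_exp {A : Matrix ι ι ℂ} (hA : A.IsHermitian) : (exp A).PosSemidef := by
  simpa using posSemidef_exp_add_quadratic hA (s := 1) (α := 0) (β := 0) (γ := 0)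
    fun i => by simpa using (Real.exp_pos _).le

/-- `exp A ≤ 1 + A + A²` for a Hermitian contraction `A`. -/
theorem posSemidef_quadratic_sub_exp {A : Matrix ι ι ℂ} (hA : A.IsHermitian) (h1 : ‖A‖ ≤ 1) :
    (1 + A + A ^ 2 - exp A).PosSemidef := by
  have h := posSemidef_exp_add_quadratic hA (s := -1) (α := 1) (β := 1) (γ := 1) fun i => by
    have := (abs_le.1 (Real.abs_exp_sub_one_sub_id_le
      ((abs_eigenvalues_le_norm hA i).trans h1))).2
    linarith
  convert h using 1
  simp only [one_smul, neg_smul]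
  abel

theorem posSemidef_smul_one_sub {A : Matrix ι ι ℂ} (hA : A.IsHermitian) {r : ℝ} (hr : ‖A‖ ≤ r) :
    (r • 1 - A).PosSemidef := by
  have h := posSemidef_exp_add_quadratic hA (s := 0) (α := r) (β := -1) (γ := 0) fun i => by
    have := (abs_le.1 ((abs_eigenvalues_le_norm hA i).trans hr)).2
    linarith
  convert h using 1
  simp only [one_smul, neg_smul, zero_smul]
  abel

/-- `tr (P Q) ≤ r tr P` whenever `P` is positive semidefinite and `Q ≤ r`. -/
theorem re_trace_mul_le {P Q : Matrix ι ι ℂ} (hP : P.PosSemidef) {r : ℝ}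
    (hQ : (r • 1 - Q).PosSemidef) : (P * Q).trace.re ≤ r * P.trace.re := by
  -- With `P = Sᴴ S`, the claim is that `S (r - Q) Sᴴ` has nonnegative trace.
  obtain ⟨S, rfl⟩ := CStarAlgebra.nonneg_iff_eq_star_mul_self.1 hP.nonneg
  have h := (Complex.le_def.1 (hQ.mul_mul_conjTranspose_same S).trace_nonneg).1
  rw [trace_mul_comm, ← mul_assoc, ← star_eq_conjTranspose, mul_sub, trace_sub] at h
  simp only [mul_smul_comm, mul_one, trace_smul, Complex.zero_re, Complex.sub_re,
    Complex.real_smul, Complex.re_ofReal_mul] at h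
  linarith

/-- The exponential lies above its tangent at `s = Re A j j`. Transferred to `A` and read at entry
`(j, j)`, the tangent takes the value `e^s`. -/
theorem exp_re_diag_le {A : Matrix ι ι ℂ} (hA : A.IsHermitian) (j : ι) :
    Real.exp (A j j).re ≤ (exp A j j).re := by
  set s := (A j j).re
  have h := posSemidef_exp_add_quadratic hA (s := 1) (α := Real.exp s * (s - 1))
    (β := -Real.exp s) (γ := 0) fun i => by
      have h1 := Real.add_one_le_exp (hA.eigenvalues i - s)
      rw [Real.exp_sub, le_div_iff₀ (Real.exp_pos s)] at h1
      linarith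
  have h2 := (Complex.le_def.1 (h.diag_nonneg (i := j))).1
  simp only [add_apply, smul_apply, one_apply_eq, Complex.zero_re, Complex.add_re,
    Complex.real_smul, Complex.re_ofReal_mul, Complex.one_re] at h2
  change 0 ≤ 1 * (exp A j j).re + _ + -Real.exp s * s + _ at h2
  linarith

/-- The Peierls inequality. -/
theorem sum_exp_re_diag_unitary_conj_le {A : Matrix ι ι ℂ} (hA : A.IsHermitian)
    (U : unitaryGroup ι ℂ) :
    ∑ j, Real.exp (((U : Matrix ι ι ℂ) * A * star (U : Matrix ι ι ℂ)) j j).re ≤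
      (exp A).trace.re := by
  rw [← trace_unitary_conj U, ← exp_unitary_conj, trace, Complex.re_sum]
  exact Finset.sum_le_sum fun j _ => exp_re_diag_le (isHermitian_mul_mul_conjTranspose _ hA) j

/-- In an eigenbasis of `aA + bB`, its eigenvalues are the same combinations of the diagonal entries
of `A` and `B`. Scalar convexity of `exp` and then Peierls for `A` and `B` finish. -/
theorem convexOn_re_trace_exp :
    ConvexOn ℝ {A : Matrix ι ι ℂ | A.IsHermitian} fun A => (exp A).trace.re := by
  have hsmul : ∀ {C : Matrix ι ι ℂ} (r : ℝ), C.IsHermitian → (r • C).IsHermitian := fun r hC =>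
    hC.smul (IsSelfAdjoint.all r)
  refine ⟨fun A hA B hB a b _ _ _ => (hsmul a hA).add (hsmul b hB),
    fun A hA B hB a b ha hb hab => ?_⟩
  have hS : (a • A + b • B).IsHermitian := (hsmul a hA).add (hsmul b hB)
  set U := star hS.eigenvectorUnitary with hU
  set φ : Matrix ι ι ℂ → ι → ℝ :=
    fun M j => (((U : Matrix ι ι ℂ) * M * star (U : Matrix ι ι ℂ)) j j).re with hφ
  have hev : ∀ j, hS.eigenvalues j = a * φ A j + b * φ B j := fun j => by
    have h1 : φ (a • A + b • B) j = hS.eigenvalues j := by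
      have h := hS.conjStarAlgAut_star_eigenvectorUnitary
      rw [Unitary.conjStarAlgAut_apply] at h
      simp only [hφ]
      rw [h]
      simp
    rw [← h1]
    simp [hφ, mul_add, add_mul]
  have htr := re_trace_exp_smul hS 1
  simp only [one_smul, one_mul] at htr
  simp only [smul_eq_mul]
  calc (exp (a • A + b • B)).trace.re = ∑ j, Real.exp (a * φ A j + b * φ B j) := by
        rw [htr]; simp only [hev]
    _ ≤ ∑ j, (a * Real.exp (φ A j) + b * Real.exp (φ B j)) :=
        Finset.sum_le_sum fun j _ =>
          convexOn_exp.2 (Set.mem_univ (φ A j)) (Set.mem_univ (φ B j)) ha hb hab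
    _ = a * ∑ j, Real.exp (φ A j) + b * ∑ j, Real.exp (φ B j) := by
        rw [Finset.sum_add_distrib, Finset.mul_sum, Finset.mul_sum]
    _ ≤ _ := by
        gcongr
        · exact sum_exp_re_diag_unitary_conj_le hA U
        · exact sum_exp_re_diag_unitary_conj_le hB U

/-- The eigenvalue of large modulus may have either sign; this is the source of the factor 2 in the
tail bound. -/
theorem exp_mul_le_of_lt_norm {A : Matrix ι ι ℂ} (hA : A.IsHermitian) {r t : ℝ} (hr : 0 ≤ r)
    (ht : 0 ≤ t) (h : t < ‖A‖) :
    Real.exp (r * t) ≤ (exp (r • A)).trace.re + (exp (-r • A)).trace.re := by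
  obtain ⟨i, hi⟩ : ∃ i, t < |hA.eigenvalues i| := by
    by_contra! hcon
    rw [norm_eq_norm_eigenvalues hA] at h
    exact absurd ((pi_norm_le_iff_of_nonneg ht).2 hcon) h.not_ge
  rw [re_trace_exp_smul hA, re_trace_exp_smul hA, ← Finset.sum_add_distrib]
  refine le_trans ?_ (Finset.single_le_sum (f := fun i => Real.exp (r * hA.eigenvalues i) +
    Real.exp (-r * hA.eigenvalues i)) (fun i _ => by positivity) (Finset.mem_univ i))
  rcases lt_abs.1 hi with h1 | h1
  · have : Real.exp (r * t) ≤ Real.exp (r * hA.eigenvalues i) := Real.exp_le_exp.2 (by gcongr)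
    linarith [Real.exp_pos (-r * hA.eigenvalues i)]
  · have : Real.exp (r * t) ≤ Real.exp (-r * hA.eigenvalues i) :=
      Real.exp_le_exp.2 (by rw [neg_mul_comm]; gcongr)
    linarith [Real.exp_pos (r * hA.eigenvalues i)]

end Matrix

/-! ### The matrix moment generating function, with replacement. -/

namespace Matrix

open NormedSpace
open scoped ComplexOrder MatrixOrder

variable {ι : Type*}

theorem isHermitian_finsetSum {κ : Type*} (s : Finset κ) {a : κ → Matrix ι ι ℂ}
    (ha : ∀ i, (a i).IsHermitian) : (∑ i ∈ s, a i).IsHermitian :=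
  isSelfAdjoint_sum s fun i _ => ha i

variable [Fintype ι] [DecidableEq ι]

theorem trace_mul_nonneg {P Q : Matrix ι ι ℂ} (hP : P.PosSemidef) (hQ : Q.PosSemidef) :
    0 ≤ (P * Q).trace := by
  obtain ⟨S, rfl⟩ := CStarAlgebra.nonneg_iff_eq_star_mul_self.1 hP.nonneg
  have h := (hQ.mul_mul_conjTranspose_same S).trace_nonneg
  rwa [trace_mul_comm, ← mul_assoc] at h

/-- The **Golden–Thompson inequality** for the real parts of the (real) traces. -/
theorem re_trace_exp_add_le {A B : Matrix ι ι ℂ} (hA : A.IsHermitian) (hB : B.IsHermitian) :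
    (exp (A + B)).trace.re ≤ (exp A * exp B).trace.re := by
  refine (Complex.re_le_norm _).trans
    ((norm_trace_exp_add_le_of_isHermitian hA hB).trans_eq ?_)
  have h := trace_mul_nonneg (posSemidef_exp hA) (posSemidef_exp hB)
  exact (Complex.re_eq_norm.2 h).symm

variable {κ : Type*} [Fintype κ]

/-- The trace of the moment generating function of a sum of independent uniform samples from the
family `a` (unnormalised) is controlled by an upper bound for `∑ j, exp (a j)`. -/
theorem sum_re_trace_exp_sum_le {a : κ → Matrix ι ι ℂ} (ha : ∀ j, (a j).IsHermitian) {r : ℝ}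
    (hr0 : 0 ≤ r) (hr : (r • 1 - ∑ j, exp (a j)).PosSemidef) (k : ℕ) :
    ∑ x : Fin k → κ, (exp (∑ i, a (x i))).trace.re ≤ r ^ k * Fintype.card ι := by
  induction k with
  | zero => simp
  | succ k ih =>
    -- One sample `j` is split off from the tuple. Golden–Thompson isolates `exp (a j)`, and the sum
    -- over `j` is then at most `r`.
    rw [← (Fin.consEquiv fun _ => κ).sum_comp, Fintype.sum_prod_type, Finset.sum_comm]
    calc ∑ y : Fin k → κ, ∑ j, (exp (∑ i, a (Fin.consEquiv (fun _ => κ) (j, y) i))).trace.re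
        ≤ ∑ y : Fin k → κ, ∑ j, (exp (∑ i, a (y i)) * exp (a j)).trace.re := by
          refine Finset.sum_le_sum fun y _ => Finset.sum_le_sum fun j _ => ?_
          have h : ∑ i, a (Fin.consEquiv (fun _ => κ) (j, y) i) = ∑ i, a (y i) + a j := by
            rw [Fin.sum_univ_succ, add_comm]
            simp [Fin.consEquiv]
          rw [h]
          exact re_trace_exp_add_le (isHermitian_finsetSum _ fun i => ha (y i)) (ha j)
      _ = ∑ y : Fin k → κ, (exp (∑ i, a (y i)) * ∑ j, exp (a j)).trace.re := by
          simp only [Finset.mul_sum, trace_sum, Complex.re_sum]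
      _ ≤ ∑ y : Fin k → κ, r * (exp (∑ i, a (y i))).trace.re :=
          Finset.sum_le_sum fun y _ =>
            re_trace_mul_le (posSemidef_exp (isHermitian_finsetSum _ fun i => ha (y i))) hr
      _ ≤ r ^ (k + 1) * Fintype.card ι := by
          rw [← Finset.mul_sum, pow_succ', mul_assoc]
          gcongr

/-- Summing `exp A ≤ 1 + A + A²` over the family, centering removes the linear term. -/
theorem posSemidef_sub_sum_exp_smul {a : κ → Matrix ι ι ℂ} (ha : ∀ j, (a j).IsHermitian)
    (hsum : ∑ j, a j = 0) {l v : ℝ} (hl : ∀ j, ‖l • a j‖ ≤ 1) (hv : ‖∑ j, a j ^ 2‖ ≤ v) :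
    (((Fintype.card κ : ℝ) + l ^ 2 * v) • 1 - ∑ j, exp (l • a j)).PosSemidef := by
  have h1 : ∀ j, (1 + l • a j + (l • a j) ^ 2 - exp (l • a j)).PosSemidef := fun j =>
    posSemidef_quadratic_sub_exp ((ha j).smul (IsSelfAdjoint.all l)) (hl j)
  have h2 : (v • 1 - ∑ j, a j ^ 2).PosSemidef :=
    posSemidef_smul_one_sub (isHermitian_finsetSum _ fun j => (ha j).pow 2) hv
  have h3 := (posSemidef_sum Finset.univ fun j _ => h1 j).add (h2.smul (sq_nonneg l))
  convert h3 using 1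
  simp only [Finset.sum_sub_distrib, Finset.sum_add_distrib, ← Finset.smul_sum, hsum, smul_pow,
    Finset.sum_const, Finset.card_univ, smul_zero, smul_sub, add_smul, mul_smul,
    Nat.cast_smul_eq_nsmul]
  abel

theorem sum_re_trace_exp_smul_sum_le {a : κ → Matrix ι ι ℂ} (ha : ∀ j, (a j).IsHermitian)
    (hsum : ∑ j, a j = 0) {l v : ℝ} (hl : ∀ j, ‖l • a j‖ ≤ 1)
    (hv : ‖∑ j, a j ^ 2‖ ≤ Fintype.card κ * v) (k : ℕ) :
    ∑ x : Fin k → κ, (exp (l • ∑ i, a (x i))).trace.re ≤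
      (Fintype.card κ : ℝ) ^ k * (Fintype.card ι * Real.exp (l ^ 2 * (k * v))) := by
  have hv0 : 0 ≤ Fintype.card κ * v := (norm_nonneg _).trans hv
  have h := sum_re_trace_exp_sum_le (fun j => (ha j).smul (IsSelfAdjoint.all l)) (by positivity)
    (posSemidef_sub_sum_exp_smul ha hsum hl hv) k
  simp only [← Finset.smul_sum] at h
  refine h.trans ?_
  have h1 : (Fintype.card κ : ℝ) + l ^ 2 * (Fintype.card κ * v) ≤
      Fintype.card κ * Real.exp (l ^ 2 * v) := by
    have := mul_le_mul_of_nonneg_left (Real.add_one_le_exp (l ^ 2 * v))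
      (Nat.cast_nonneg (α := ℝ) (Fintype.card κ))
    linarith
  calc _ ≤ (Fintype.card κ * Real.exp (l ^ 2 * v)) ^ k * (Fintype.card ι : ℝ) := by gcongr
    _ = _ := by
      rw [mul_pow, ← Real.exp_nat_mul, mul_left_comm (k : ℝ)]
      ring

end Matrix

/-! ### Hoeffding's comparison of the two sampling schemes. -/

section Hoeffding

variable {κ : Type*} [Fintype κ] {m : ℕ}

/-- The image of a fixed embedding under a uniform permutation is a uniform embedding. -/
theorem card_embedding_mul_sum_perm [DecidableEq κ] (G : (Fin m ↪ κ) → ℝ) (e : Fin m ↪ κ) :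
    (Fintype.card (Fin m ↪ κ) : ℝ) * ∑ π : Equiv.Perm κ, G (e.trans π.toEmbedding) =
      Fintype.card (Equiv.Perm κ) * ∑ y, G y := by
  -- Pairs `(e', π)` are summed in two orders. By multiple transitivity of the symmetric group, the
  -- sum over `π` does not depend on `e'`.
  have htrans : ∀ e' : Fin m ↪ κ, ∑ π : Equiv.Perm κ, G (e'.trans π.toEmbedding) =
      ∑ π : Equiv.Perm κ, G (e.trans π.toEmbedding) := fun e' => by
    obtain ⟨ρ, rfl⟩ := (MulAction.isMultiplyPretransitive_iff (G := Equiv.Perm κ)).1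
      (Equiv.Perm.isMultiplyPretransitive κ m) e e'
    exact Equiv.sum_comp (Equiv.mulRight ρ) fun π => G (e.trans π.toEmbedding)
  have hperm : ∀ π : Equiv.Perm κ, ∑ e' : Fin m ↪ κ, G (e'.trans π.toEmbedding) = ∑ y, G y :=
    fun π => (Equiv.embeddingCongr (Equiv.refl (Fin m)) π).sum_comp G
  calc _ = ∑ e' : Fin m ↪ κ, ∑ π : Equiv.Perm κ, G (e'.trans π.toEmbedding) := by
        simp [htrans]
    _ = _ := by
        rw [Finset.sum_comm]
        simp [hperm]

/-- Enumerate an `m`-element set containing all values of `x`; the repetitions of `x` are then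
carried by `h`. -/
theorem exists_embedding_comp_eq [DecidableEq κ] (hm : m ≤ Fintype.card κ) (x : Fin m → κ) :
    ∃ (e : Fin m ↪ κ) (h : Fin m → Fin m), ∀ i, x i = e (h i) := by
  obtain ⟨t, hxt, ht⟩ := Finset.exists_superset_card_eq (s := Finset.univ.image x) (n := m)
    (Finset.card_image_le.trans_eq (Finset.card_fin m)) hm
  let φ := t.equivFinOfCardEq ht
  refine ⟨φ.symm.toEmbedding.trans (Function.Embedding.subtype _),
    fun i => φ ⟨x i, hxt (Finset.mem_image_of_mem x (Finset.mem_univ i))⟩, fun i => ?_⟩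
  simp

variable {E : Type*} [AddCommGroup E] [Module ℝ E] {s : Set E} {f : E → ℝ} {a : κ → E}

/-- Among the linear combinations `∑ i, a (y (h i))` of a uniform sample `y` of distinct elements,
the sum of the sample has the smallest expectation under a convex function. -/
theorem ConvexOn.sum_embedding_le [NeZero m] (hf : ConvexOn ℝ s f)
    (hs : ∀ x : Fin m → κ, ∑ i, a (x i) ∈ s) (h : Fin m → Fin m) :
    ∑ y : Fin m ↪ κ, f (∑ j, a (y j)) ≤ ∑ y : Fin m ↪ κ, f (∑ i, a (y (h i))) := by
  have hm : (m : ℝ) ≠ 0 := Nat.cast_ne_zero.2 (NeZero.ne m)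
  -- Jensen over cyclic shifts: as `k` varies, `h i + k` runs once through `Fin m` for every `i`, so
  -- the shifted sums average to `∑ j, a (y j)`.
  have hJ : ∀ y : Fin m ↪ κ, f (∑ j, a (y j)) ≤
      ∑ k : Fin m, (m : ℝ)⁻¹ * f (∑ i, a (y (h i + k))) := fun y => by
    have h1 := hf.map_sum_le (t := Finset.univ) (w := fun _ : Fin m => (m : ℝ)⁻¹)
      (p := fun k => ∑ i, a (y (h i + k))) (fun _ _ => by positivity) (by simp [hm])
      (fun k _ => hs fun i => y (h i + k))
    have h2 : ∀ i, ∑ k : Fin m, a (y (h i + k)) = ∑ j, a (y j) := fun i =>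
      Equiv.sum_comp (Equiv.addLeft (h i)) fun j => a (y j)
    rw [← Finset.smul_sum, Finset.sum_comm] at h1
    simp only [h2, Finset.sum_const, Finset.card_univ, Fintype.card_fin,
      ← Nat.cast_smul_eq_nsmul ℝ, smul_smul, inv_mul_cancel₀ hm, one_smul] at h1
    simpa only [smul_eq_mul] using h1
  refine (Finset.sum_le_sum fun y _ => hJ y).trans_eq ?_
  -- A shift of the indices only permutes the embeddings `y`.
  have hk : ∀ k : Fin m, ∑ y : Fin m ↪ κ, f (∑ i, a (y (h i + k))) =
      ∑ y : Fin m ↪ κ, f (∑ i, a (y (h i))) := fun k =>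
    (Equiv.embeddingCongr (Equiv.addRight k).symm (Equiv.refl κ)).sum_comp
      fun y => f (∑ i, a (y (h i)))
  rw [Finset.sum_comm]
  simp only [← Finset.mul_sum, hk, Finset.sum_const, Finset.card_univ, Fintype.card_fin,
    nsmul_eq_mul]
  rw [inv_mul_cancel_left₀ hm]

/-- Hoeffding's comparison of sampling without and with replacement under a convex function. -/
theorem ConvexOn.card_pow_mul_sum_embedding_le [DecidableEq κ] [NeZero m]
    (hm : m ≤ Fintype.card κ) (hf : ConvexOn ℝ s f) (hs : ∀ x : Fin m → κ, ∑ i, a (x i) ∈ s) :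
    (Fintype.card κ : ℝ) ^ m * ∑ y : Fin m ↪ κ, f (∑ i, a (y i)) ≤
      Fintype.card (Fin m ↪ κ) * ∑ x : Fin m → κ, f (∑ i, a (x i)) := by
  have hcard : (0 : ℝ) < Fintype.card (Equiv.Perm κ) := Nat.cast_pos.2 Fintype.card_pos
  refine le_of_mul_le_mul_left ?_ hcard
  choose e h he using exists_embedding_comp_eq (κ := κ) hm
  have hperm : ∀ π : Equiv.Perm κ, ∑ x : Fin m → κ, f (∑ i, a (π (x i))) =
      ∑ x : Fin m → κ, f (∑ i, a (x i)) := fun π =>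
    (Equiv.arrowCongr (Equiv.refl (Fin m)) π).sum_comp fun x => f (∑ i, a (x i))
  -- Writing `x = e ∘ h`, a uniform `π` makes `π ∘ e` a uniform embedding, so the previous lemma
  -- applies to each `x` separately.
  have hx : ∀ x : Fin m → κ, Fintype.card (Equiv.Perm κ) * ∑ y : Fin m ↪ κ, f (∑ i, a (y i)) ≤
      Fintype.card (Fin m ↪ κ) * ∑ π : Equiv.Perm κ, f (∑ i, a (π (x i))) := fun x => by
    have h1 := card_embedding_mul_sum_perm (fun y => f (∑ i, a (y (h x i)))) (e x)
    simp only [Function.Embedding.trans_apply, Equiv.coe_toEmbedding, ← he] at h1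
    rw [h1]
    exact mul_le_mul_of_nonneg_left (hf.sum_embedding_le hs (h x)) hcard.le
  calc _ = ∑ _x : Fin m → κ,
          Fintype.card (Equiv.Perm κ) * ∑ y : Fin m ↪ κ, f (∑ i, a (y i)) := by
        simp
        ring
    _ ≤ ∑ x : Fin m → κ,
          Fintype.card (Fin m ↪ κ) * ∑ π : Equiv.Perm κ, f (∑ i, a (π (x i))) :=
        Finset.sum_le_sum fun x _ => hx x
    _ = _ := by
        rw [← Finset.mul_sum, Finset.sum_comm]
        simp only [hperm, Finset.sum_const, Finset.card_univ, nsmul_eq_mul]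
        ring

end Hoeffding

/-! ### Uniform laws on finite sets. -/

section UniformLaw

variable {α : Type*} [MeasurableSpace α] [MeasurableSingletonClass α]

theorem uniformOn_coe_finset_apply (s : Finset α) (t : Set α) [DecidablePred (· ∈ t)] :
    uniformOn (s : Set α) t = (s.filter (· ∈ t)).card / s.card := by
  classical
  have h : (s : Set α) ∩ t = (s.filter (· ∈ t) : Finset α) := by
    ext
    simp
  rw [← uniformOn_inter_self s.finite_toSet, h, uniformOn_apply_finset,
    Finset.inter_eq_right.2 (Finset.filter_subset _ _)]

theorem pi_uniformOn_finset {ι : Type*} [Fintype ι] {s : ι → Finset α} (hs : ∀ i, (s i).Nonempty) :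
    Measure.pi (fun i => uniformOn (s i : Set α)) =
      uniformOn (Set.univ.pi fun i => (s i : Set α)) := by
  classical
  have := fun i => isProbabilityMeasure_uniformOn (s i).finite_toSet (hs i)
  refine Measure.pi_eq fun t _ => ?_
  rw [← Fintype.coe_piFinset, uniformOn_coe_finset_apply]
  simp only [uniformOn_coe_finset_apply]
  rw [ENNReal.prod_div_distrib_of_ne_top (by simp)]
  have h : (Fintype.piFinset s).filter (· ∈ Set.univ.pi t) =
      Fintype.piFinset fun i => (s i).filter (· ∈ t i) := by
    ext x
    simp [forall_and]
  rw [h, Fintype.card_piFinset, Fintype.card_piFinset]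
  push_cast
  rfl

/-- Markov's inequality for a uniform law on the range of an injection from a finite type. -/
theorem ProbabilityTheory.HasLaw.measureReal_le_of_uniformOn_range {Ω : Type*} [MeasurableSpace Ω]
    {P : Measure Ω} [IsProbabilityMeasure P] {β : Type*} [Fintype β] [Nonempty β] {φ : β → α}
    (hφ : Function.Injective φ) {Z : Ω → α} (hZ : HasLaw Z (uniformOn (Set.range φ)) P)
    {p : α → Prop} {g : β → ℝ} (hg0 : ∀ b, 0 ≤ g b) (hg1 : ∀ b, p (φ b) → 1 ≤ g b) :
    P.real {ω | p (Z ω)} ≤ (∑ b, g b) / Fintype.card β := by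
  classical
  set s : Finset α := Finset.univ.image φ with hs
  have hcoe : (s : Set α) = Set.range φ := by simp [hs]
  have hcard : s.card = Fintype.card β := Finset.card_image_of_injective _ hφ
  -- The set where `p` holds need not be measurable; the complement of the finite set `T` contains
  -- it, is measurable, and agrees with it on `s`.
  set T : Finset α := s.filter (fun z => ¬ p z) with hT
  rw [← hcoe] at hZ
  have hle : P.real {ω | p (Z ω)} ≤ P.real {ω | Z ω ∉ T} :=
    measureReal_mono fun ω hω hmem => (Finset.mem_filter.1 hmem).2 hω
  have hmeas : MeasurableSet {z | z ∉ T} := (Finset.measurableSet T).compl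
  refine hle.trans ?_
  rw [hZ.measureReal_eq hmeas, measureReal_def, uniformOn_coe_finset_apply, ENNReal.toReal_div,
    ENNReal.toReal_natCast, ENNReal.toReal_natCast, hcard]
  gcongr
  have hfil : s.filter (· ∈ {z | z ∉ T}) = s.filter p := by
    ext z
    simp +contextual [hT]
  rw [hfil, Finset.card_filter, hs, Finset.sum_image hφ.injOn]
  push_cast
  refine Finset.sum_le_sum fun b _ => ?_
  split_ifs with h
  · exact hg1 b h
  · exact hg0 b

end UniformLaw

/-! ### Tail bounds with a free parameter. -/

namespace Matrix

open NormedSpace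

section

variable {ι κ : Type*} [Fintype ι] [DecidableEq ι] [Fintype κ] {a : κ → Matrix ι ι ℂ} {l v : ℝ}

/-- Distinct samples are dependent, so the splitting argument is not available; Hoeffding's
comparison carries the bound over. -/
theorem sum_embedding_re_trace_exp_smul_sum_le (ha : ∀ j, (a j).IsHermitian)
    (hsum : ∑ j, a j = 0) (hl : ∀ j, ‖l • a j‖ ≤ 1) (hv : ‖∑ j, a j ^ 2‖ ≤ Fintype.card κ * v)
    {m : ℕ} [NeZero m] (hm : m ≤ Fintype.card κ) :
    ∑ y : Fin m ↪ κ, (exp (l • ∑ i, a (y i))).trace.re ≤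
      Fintype.card (Fin m ↪ κ) * (Fintype.card ι * Real.exp (l ^ 2 * (m * v))) := by
  classical
  have hκ : (0 : ℝ) < Fintype.card κ := Nat.cast_pos.2 ((NeZero.pos m).trans_le hm)
  have h1 := convexOn_re_trace_exp.card_pow_mul_sum_embedding_le (m := m) hm
    (a := fun j => l • a j)
    fun x => isHermitian_finsetSum _ fun i => (ha (x i)).smul (IsSelfAdjoint.all l)
  simp only [← Finset.smul_sum] at h1
  have h2 := sum_re_trace_exp_smul_sum_le ha hsum hl hv m
  refine le_of_mul_le_mul_left (h1.trans ?_) (pow_pos hκ m)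
  rw [mul_left_comm]
  gcongr

end

variable {n m : ℕ} {C : Finset (Matrix (Fin n) (Fin n) ℂ)} {c σ₀ : ℝ}

theorem sum_coe_eq_zero_of_uniformMean (hC : C.card ≠ 0)
    (h : uniformMean C (fun A => A) = 0) : ∑ A : C, (A : Matrix (Fin n) (Fin n) ℂ) = 0 := by
  rw [Finset.sum_coe_sort C fun A => A]
  exact (smul_eq_zero.1 h).resolve_left (by simpa using hC)

theorem norm_sum_sq_le_of_uniformMean (hC : C.card ≠ 0)
    (h : ‖uniformMean C (fun A => A ^ 2)‖ ≤ σ₀ ^ 2) :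
    ‖∑ A : C, (A : Matrix (Fin n) (Fin n) ℂ) ^ 2‖ ≤ Fintype.card C * σ₀ ^ 2 := by
  have hC' : (0 : ℝ) < C.card := by positivity
  rw [uniformMean, norm_smul, norm_inv, Complex.norm_natCast, inv_mul_le_iff₀ hC'] at h
  rw [Finset.sum_coe_sort C fun A => A ^ 2, Fintype.card_coe]
  exact h

theorem range_coe_comp_eq_pi :
    Set.range (fun (x : Fin m → C) i => (x i : Matrix (Fin n) (Fin n) ℂ)) =
      Set.univ.pi fun _ => (C : Set (Matrix (Fin n) (Fin n) ℂ)) := by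
  ext z
  simp only [Set.mem_range, Set.mem_univ_pi, Finset.mem_coe]
  exact ⟨fun ⟨x, hx⟩ i => hx ▸ (x i).2, fun h => ⟨fun i => ⟨z i, h i⟩, rfl⟩⟩

theorem range_coe_comp_embedding_eq :
    Set.range (fun (y : Fin m ↪ C) i => (y i : Matrix (Fin n) (Fin n) ℂ)) =
      {y | (∀ i, y i ∈ C) ∧ Function.Injective y} := by
  ext z
  refine ⟨?_, fun h => ⟨⟨fun i => ⟨z i, h.1 i⟩, fun i j hij => h.2 (congrArg Subtype.val hij)⟩, rfl⟩⟩
  rintro ⟨y, rfl⟩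
  exact ⟨fun i => (y i).2, Subtype.val_injective.comp y.injective⟩

theorem isHermitian_sum_coe (hherm : ∀ A ∈ C, A.IsHermitian) (x : Fin m → C) :
    (∑ i, (x i : Matrix (Fin n) (Fin n) ℂ)).IsHermitian :=
  isHermitian_finsetSum _ fun i => hherm _ (x i).2

/-- This is the test function dominating the indicator of `t < ‖A‖` in Markov's inequality. -/
theorem one_le_exp_neg_mul_re_trace {A : Matrix (Fin n) (Fin n) ℂ} (hA : A.IsHermitian) {r t : ℝ}
    (hr : 0 ≤ r) (ht : 0 ≤ t) (h : t < ‖A‖) :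
    1 ≤ Real.exp (-(r * t)) * ((exp (r • A)).trace.re + (exp (-r • A)).trace.re) := by
  have := mul_le_mul_of_nonneg_left (exp_mul_le_of_lt_norm hA hr ht h)
    (Real.exp_pos (-(r * t))).le
  rwa [← Real.exp_add, neg_add_cancel, Real.exp_zero] at this

theorem exp_neg_mul_re_trace_nonneg {A : Matrix (Fin n) (Fin n) ℂ} (hA : A.IsHermitian) (r t : ℝ) :
    0 ≤ Real.exp (-(r * t)) * ((exp (r • A)).trace.re + (exp (-r • A)).trace.re) := by
  rw [re_trace_exp_smul hA, re_trace_exp_smul hA]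
  positivity

theorem mean_exp_neg_mul_le {β : Type*} [Fintype β] [Nonempty β] {F G : β → ℝ} {r t K V : ℝ}
    (hF : ∑ b, F b ≤ Fintype.card β * (K * Real.exp (r ^ 2 * V)))
    (hG : ∑ b, G b ≤ Fintype.card β * (K * Real.exp ((-r) ^ 2 * V))) :
    (∑ b, Real.exp (-(r * t)) * (F b + G b)) / Fintype.card β ≤
      2 * K * Real.exp (r ^ 2 * V - r * t) := by
  have hβ : (0 : ℝ) < Fintype.card β := Nat.cast_pos.2 Fintype.card_pos
  rw [div_le_iff₀ hβ, ← Finset.mul_sum, Finset.sum_add_distrib, sub_eq_neg_add, Real.exp_add]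
  rw [neg_sq] at hG
  calc _ ≤ Real.exp (-(r * t)) * (Fintype.card β * (K * Real.exp (r ^ 2 * V)) +
        Fintype.card β * (K * Real.exp (r ^ 2 * V))) := by gcongr
    _ = _ := by ring

variable {Ω : Type*} [MeasurableSpace Ω] {P : Measure Ω} [IsProbabilityMeasure P]
  {X : Fin m → Ω → Matrix (Fin n) (Fin n) ℂ}

/-- The exponential tail bound with a free parameter `r`, for sampling with replacement. -/
theorem measureReal_norm_sum_gt_le_of_withReplacement (hC : C.card ≠ 0)
    (hherm : ∀ A ∈ C, A.IsHermitian) (hcentered : uniformMean C (fun A => A) = 0)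
    (hbound : ∀ A ∈ C, ‖A‖ ≤ c) (hvar : ‖uniformMean C (fun A => A ^ 2)‖ ≤ σ₀ ^ 2)
    (hX : IsSampleWithReplacement P C X) {r t : ℝ} (hr : 0 ≤ r) (hrc : r * c ≤ 1) (ht : 0 ≤ t) :
    P.real {ω | ‖∑ i, X i ω‖ > t} ≤ 2 * n * Real.exp (r ^ 2 * (m * σ₀ ^ 2) - r * t) := by
  have hne : C.Nonempty := Finset.card_ne_zero.1 hC
  have : Nonempty C := hne.to_subtype
  have hlaw : HasLaw (fun ω i => X i ω) (uniformOn
      (Set.range fun (x : Fin m → C) i => (x i : Matrix (Fin n) (Fin n) ℂ))) P := by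
    rw [range_coe_comp_eq_pi, ← pi_uniformOn_finset fun _ => hne]
    exact hX.indep.hasLaw_pi hX.uniform
  have hinj : Function.Injective fun (x : Fin m → C) i => (x i : Matrix (Fin n) (Fin n) ℂ) :=
    fun x y h => funext fun i => Subtype.ext (congrFun h i)
  refine (hlaw.measureReal_le_of_uniformOn_range hinj (p := fun z => ‖∑ i, z i‖ > t)
    (fun x => exp_neg_mul_re_trace_nonneg (isHermitian_sum_coe hherm x) r t)
    fun x hx => one_le_exp_neg_mul_re_trace (isHermitian_sum_coe hherm x) hr ht hx).trans ?_
  have hmgf : ∀ l : ℝ, |l| = r → ∑ x : Fin m → C,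
      (exp (l • ∑ i, (x i : Matrix (Fin n) (Fin n) ℂ))).trace.re ≤
        Fintype.card (Fin m → C) * (n * Real.exp (l ^ 2 * (m * σ₀ ^ 2))) := fun l hl => by
    simpa using sum_re_trace_exp_smul_sum_le (a := fun A : C => (A : Matrix (Fin n) (Fin n) ℂ))
      (fun A => hherm A A.2) (sum_coe_eq_zero_of_uniformMean hC hcentered) (l := l) (fun A => by
        rw [norm_smul, Real.norm_eq_abs, hl]
        exact (mul_le_mul_of_nonneg_left (hbound A A.2) hr).trans hrc)
      (norm_sum_sq_le_of_uniformMean hC hvar) m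
  exact mean_exp_neg_mul_le (hmgf r (abs_of_nonneg hr))
    (hmgf (-r) (by rw [abs_neg, abs_of_nonneg hr]))

/-- The exponential tail bound with a free parameter `r`, for sampling without replacement. -/
theorem measureReal_norm_sum_gt_le_of_withoutReplacement [NeZero m] (hmC : m ≤ C.card)
    (hherm : ∀ A ∈ C, A.IsHermitian) (hcentered : uniformMean C (fun A => A) = 0)
    (hbound : ∀ A ∈ C, ‖A‖ ≤ c) (hvar : ‖uniformMean C (fun A => A ^ 2)‖ ≤ σ₀ ^ 2)
    (hX : IsSampleWithoutReplacement P C X) {r t : ℝ} (hr : 0 ≤ r) (hrc : r * c ≤ 1)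
    (ht : 0 ≤ t) :
    P.real {ω | ‖∑ i, X i ω‖ > t} ≤ 2 * n * Real.exp (r ^ 2 * (m * σ₀ ^ 2) - r * t) := by
  have hC : C.card ≠ 0 := ((NeZero.pos m).trans_le hmC).ne'
  have : Nonempty (Fin m ↪ C) := Function.Embedding.nonempty_of_card_le (by simpa using hmC)
  have hlaw : HasLaw (fun ω i => X i ω) (uniformOn
      (Set.range fun (y : Fin m ↪ C) i => (y i : Matrix (Fin n) (Fin n) ℂ))) P := by
    rw [range_coe_comp_embedding_eq]
    exact hX
  have hinj : Function.Injective fun (y : Fin m ↪ C) i => (y i : Matrix (Fin n) (Fin n) ℂ) :=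
    fun x y h => Function.Embedding.ext fun i => Subtype.ext (congrFun h i)
  refine (hlaw.measureReal_le_of_uniformOn_range hinj (p := fun z => ‖∑ i, z i‖ > t)
    (fun y => exp_neg_mul_re_trace_nonneg (isHermitian_sum_coe hherm y) r t)
    fun y hy => one_le_exp_neg_mul_re_trace (isHermitian_sum_coe hherm y) hr ht hy).trans ?_
  have hmgf : ∀ l : ℝ, |l| = r → ∑ y : Fin m ↪ C,
      (exp (l • ∑ i, (y i : Matrix (Fin n) (Fin n) ℂ))).trace.re ≤
        Fintype.card (Fin m ↪ C) * (n * Real.exp (l ^ 2 * (m * σ₀ ^ 2))) := fun l hl => by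
    have h := sum_embedding_re_trace_exp_smul_sum_le
      (a := fun A : C => (A : Matrix (Fin n) (Fin n) ℂ))
      (fun A => hherm A A.2) (sum_coe_eq_zero_of_uniformMean hC hcentered) (l := l) (fun A => by
        rw [norm_smul, Real.norm_eq_abs, hl]
        exact (mul_le_mul_of_nonneg_left (hbound A A.2) hr).trans hrc)
      (norm_sum_sq_le_of_uniformMean hC hvar) (m := m) (by simpa using hmC)
    rwa [Fintype.card_fin n] at h
  exact mean_exp_neg_mul_le (hmgf r (abs_of_nonneg hr))
    (hmgf (-r) (by rw [abs_neg, abs_of_nonneg hr]))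

end Matrix

/-! ### Choice of the parameter. -/

theorem theorem1 {n m : ℕ} (C : Finset (Matrix (Fin n) (Fin n) ℂ)) (c σ₀ : ℝ)
    (hm : 1 ≤ m) (hmC : m ≤ C.card)
    (hherm : ∀ A ∈ C, A.IsHermitian)
    (hcentered : uniformMean C (fun A => A) = 0)
    (hbound : ∀ A ∈ C, ‖A‖ ≤ c)
    (hvar : ‖uniformMean C (fun A => A ^ 2)‖ ≤ σ₀ ^ 2)
    {Ω : Type*} [MeasurableSpace Ω] (P : Measure Ω) [IsProbabilityMeasure P]
    (X : Fin m → Ω → Matrix (Fin n) (Fin n) ℂ) (hX : IsSampleWithReplacement P C X)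
    {Ω' : Type*} [MeasurableSpace Ω'] (P' : Measure Ω') [IsProbabilityMeasure P']
    (Y : Fin m → Ω' → Matrix (Fin n) (Fin n) ℂ) (hY : IsSampleWithoutReplacement P' C Y)
    (V : ℝ) (hV : V = m * σ₀ ^ 2) (t : ℝ) (ht : 0 ≤ t) :
    (t ≤ 2 * V / c →
      P.real {ω | ‖∑ i, X i ω‖ > t} ≤ 2 * n * Real.exp (-(t ^ 2 / (4 * V))) ∧
      P'.real {ω | ‖∑ i, Y i ω‖ > t} ≤ 2 * n * Real.exp (-(t ^ 2 / (4 * V)))) ∧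
    (2 * V / c < t →
      P.real {ω | ‖∑ i, X i ω‖ > t} ≤ 2 * n * Real.exp (-(t / (2 * c))) ∧
      P'.real {ω | ‖∑ i, Y i ω‖ > t} ≤ 2 * n * Real.exp (-(t / (2 * c)))) := by
  have : NeZero m := ⟨by lia⟩
  have hC : C.card ≠ 0 := by lia
  obtain ⟨A, hA⟩ : C.Nonempty := Finset.card_ne_zero.1 hC
  have hc : 0 ≤ c := (norm_nonneg A).trans (hbound A hA)
  have hV0 : 0 ≤ V := by rw [hV]; positivity
  have key : ∀ r : ℝ, 0 ≤ r → r * c ≤ 1 → ∀ q : ℝ, r ^ 2 * V - r * t ≤ q →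
      P.real {ω | ‖∑ i, X i ω‖ > t} ≤ 2 * n * Real.exp q ∧
      P'.real {ω | ‖∑ i, Y i ω‖ > t} ≤ 2 * n * Real.exp q := fun r hr hrc q hq => by
    rw [hV] at hq
    have hexp : 2 * (n : ℝ) * Real.exp (r ^ 2 * (m * σ₀ ^ 2) - r * t) ≤ 2 * n * Real.exp q := by
      gcongr
    exact ⟨(Matrix.measureReal_norm_sum_gt_le_of_withReplacement hC hherm hcentered hbound hvar hX
        hr hrc ht).trans hexp,
      (Matrix.measureReal_norm_sum_gt_le_of_withoutReplacement hmC hherm hcentered hbound hvar hY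
        hr hrc ht).trans hexp⟩
  -- For `V, c > 0`, `t / (2V)` minimises `r²V - rt` and meets `rc ≤ 1` exactly when `t ≤ 2V/c`;
  -- beyond that the endpoint `1/c` is used. A zero denominator makes the chosen `r` zero, and the
  -- bound is then `2n`, except that `c = 0 < V` in the first regime keeps `r = t / (2V)`, which `rc
  -- ≤ 1` does not restrict.
  refine ⟨fun h => key (t / (2 * V)) (by positivity) ?_ _ ?_,
    fun h => key c⁻¹ (by positivity) (inv_mul_le_one_of_le₀ le_rfl hc) _ ?_⟩
  · rcases hc.eq_or_lt with rfl | hc'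
    · simp
    · rw [div_mul_eq_mul_div]
      exact div_le_one_of_le₀ ((le_div_iff₀ hc').1 h) (by positivity)
  · rcases hV0.eq_or_lt with rfl | hV'
    · simp
    · refine le_of_eq ?_
      field_simp
      ring
  · rcases hc.eq_or_lt with rfl | hc'
    · simp
    · have h1 : V < t * c / 2 := by
        rw [div_lt_iff₀ hc'] at h
        linarith
      have h2 : c⁻¹ ^ 2 * V ≤ c⁻¹ ^ 2 * (t * c / 2) := by gcongr
      have h3 : c⁻¹ ^ 2 * (t * c / 2) - c⁻¹ * t = -(t / (2 * c)) := by
        field_simp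
        ring
      linarith
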